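/- **Definitions.** A *cover* of a set $X$ is a family of subsets of $X$ with union $X$; a family $\mathcal U$ *refines* $\mathcal V$ if every member of $\mathcal U$ is contained in a member of $\mathcal V$. A *pre-uniformity* on $X$ is a nonempty set $\mu$ of covers of $X$ that contains every cover refined by a member of $\mu$ and that contains $\{U\cap V: U\in\mathcal U, V\in\mathcal V\}$ whenever $\mathcal U,\mathcal V\in\mu$. For pre-uniformities $\mu,\nu$ on $X$, $\mu/\nu$ is the pre-uniformity generated by all covers $\{U_i\cap V^i_j\}$ with $\{U_i\}\in\mu$ and, for each $i$, $\{V^i_j\}_j\in\nu$. The *locally fine coreflection* $\lambda\mu$ is the smallest pre-uniformity $\nu\supseteq\mu$ with $\nu/\nu\subseteq\nu$. Given pre-uniformities $\mu_i$ on $X_i$, the product pre-uniformity $\Pi\mu_i$ on $\prod X_i$ is generated by the covers $\{\pi_i^{-1}[U]: U\in\mathcal U\}$ with $\mathcal U\in\mu_i$. A pre-uniformity on a topological space is *supercomplete* if it contains every open cover of the space. A *left-open partition* of a space $X$ is a partition of $X$ together with a well-ordering $\{P_\alpha:\alpha<\beta\}$ of its members such that $\bigcup_{\alpha\le\gamma}P_\alpha$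 is open for all $\gamma<\beta$. The space $X$ is *partition-complete* if it has a sequence $(\mathcal P_n)_{n\in\mathbb N}$ of left-open partitions such that (1) $\mathcal P_{n+1}$ refines $\mathcal P_n$; (2) if $Q\subseteq P$, $Q'\subseteq P'$ with $P,P'\in\mathcal P_n$, $Q,Q'\in\mathcal P_{n+1}$ and $P<P'$, then $Q<Q'$; (3) every proper filter on $X$ that contains a member of each $\mathcal P_n$ has a cluster point. **Theorem.** Let $(X_i)_{i\in I}$ be a countable family of partition-complete regular spaces (no separation axiom beyond regularity is assumed), and for each $i$ let $\mu_i$ be a supercomplete pre-uniformity on $X_i$. Then $\lambda\Pi\mu_i$ is a supercomplete pre-uniformity for the topological product $\prod_{i\in I} X_i$, i.e. every open cover of $\prod_{i\in I} X_i$ belongs to $\lambda\Pi\mu_i$. -/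

import Mathlib

universe u v

/-- `Refines 𝒰 𝒱` (written `𝒰 ≺ 𝒱`): every member of `𝒰` is contained in a member of `𝒱`. -/
def Refines {X : Type u} (𝒰 𝒱 : Set (Set X)) : Prop :=
  ∀ U ∈ 𝒰, ∃ V ∈ 𝒱, U ⊆ V

/-- A pre-uniformity on a set `X`: a (nonempty) filter of covers of `X` with respect to
refinement. -/
structure PreUniformity (X : Type u) where
  /-- The uniform covers. -/
  covers : Set (Set (Set X))
  sUnion_eq : ∀ 𝒰 ∈ covers, ⋃₀ 𝒰 = Set.univ
  nonempty : covers.Nonempty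
  of_refines : ∀ 𝒰 ∈ covers, ∀ 𝒱 : Set (Set X), Refines 𝒰 𝒱 → 𝒱 ∈ covers
  inter_mem : ∀ 𝒰 ∈ covers, ∀ 𝒱 ∈ covers, Set.image2 (· ∩ ·) 𝒰 𝒱 ∈ covers

namespace PreUniformity

/-- The pre-uniformity `μ/ν` generated by all covers `{Uᵢ ∩ Vⁱⱼ}` with `{Uᵢ} ∈ μ` and, for each
`i`, `{Vⁱⱼ} ∈ ν`. Here `𝒱 U` is the cover attached to the member `U` of `𝒰`. These covers are
closed under common refinements, so the generated filter is their upward closure. -/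
def quotient {X : Type u} (μ ν : PreUniformity X) : PreUniformity X where
  covers := {𝒲 | ∃ 𝒰 ∈ μ.covers, ∃ 𝒱 : Set X → Set (Set X), (∀ U ∈ 𝒰, 𝒱 U ∈ ν.covers) ∧
    Refines {S | ∃ U ∈ 𝒰, ∃ V ∈ 𝒱 U, S = U ∩ V} 𝒲}
  sUnion_eq := by
    rintro 𝒲 ⟨𝒰, h𝒰, 𝒱, h𝒱, hr⟩
    refine Set.eq_univ_of_forall fun x => ?_
    obtain ⟨U, hU, hx⟩ := Set.mem_sUnion.1 ((μ.sUnion_eq 𝒰 h𝒰).symm ▸ Set.mem_univ x)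
    obtain ⟨V, hV, hx'⟩ :=
      Set.mem_sUnion.1 ((ν.sUnion_eq _ (h𝒱 U hU)).symm ▸ Set.mem_univ x)
    obtain ⟨W, hW, hs⟩ := hr (U ∩ V) ⟨U, hU, V, hV, rfl⟩
    exact ⟨W, hW, hs ⟨hx, hx'⟩⟩
  nonempty := by
    obtain ⟨𝒰, h𝒰⟩ := μ.nonempty
    obtain ⟨𝒱, h𝒱⟩ := ν.nonempty
    exact ⟨_, 𝒰, h𝒰, fun _ => 𝒱, fun _ _ => h𝒱, fun S hS => ⟨S, hS, subset_rfl⟩⟩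
  of_refines := by
    rintro 𝒲 ⟨𝒰, h𝒰, 𝒱, h𝒱, hr⟩ 𝒲' hr'
    refine ⟨𝒰, h𝒰, 𝒱, h𝒱, fun S hS => ?_⟩
    obtain ⟨W, hW, hs⟩ := hr S hS
    obtain ⟨W', hW', hs'⟩ := hr' W hW
    exact ⟨W', hW', hs.trans hs'⟩
  inter_mem := by
    rintro 𝒲 ⟨𝒰, h𝒰, 𝒱, h𝒱, hr⟩ 𝒲' ⟨𝒰', h𝒰', 𝒱', h𝒱', hr'⟩
    have key : ∀ A : Set X, ∃ p : Set X × Set X, A ∈ Set.image2 (· ∩ ·) 𝒰 𝒰' →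
        p.1 ∈ 𝒰 ∧ p.2 ∈ 𝒰' ∧ p.1 ∩ p.2 = A := by
      intro A
      by_cases hA : A ∈ Set.image2 (· ∩ ·) 𝒰 𝒰'
      · obtain ⟨U, hU, U', hU', h⟩ := hA
        exact ⟨(U, U'), fun _ => ⟨hU, hU', h⟩⟩
      · exact ⟨(∅, ∅), fun h => absurd h hA⟩
    choose p hp using key
    refine ⟨_, μ.inter_mem 𝒰 h𝒰 𝒰' h𝒰',
      fun A => Set.image2 (· ∩ ·) (𝒱 (p A).1) (𝒱' (p A).2), ?_, ?_⟩
    · intro A hA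
      exact ν.inter_mem _ (h𝒱 _ (hp A hA).1) _ (h𝒱' _ (hp A hA).2.1)
    · rintro S ⟨A, hA, _, ⟨V, hV, V', hV', rfl⟩, rfl⟩
      obtain ⟨h1, h2, h3⟩ := hp A hA
      obtain ⟨W, hW, hs⟩ := hr _ ⟨_, h1, V, hV, rfl⟩
      obtain ⟨W', hW', hs'⟩ := hr' _ ⟨_, h2, V', hV', rfl⟩
      refine ⟨W ∩ W', ⟨W, hW, W', hW', rfl⟩, ?_⟩
      rintro x ⟨hx, hxV, hxV'⟩
      rw [← h3] at hx
      exact ⟨hs ⟨hx.1, hxV⟩, hs' ⟨hx.2, hxV'⟩⟩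

/-- A pre-uniformity `ν` is locally fine if it is closed under `ν ↦ ν/ν`. -/
def IsLocallyFine {X : Type u} (ν : PreUniformity X) : Prop :=
  (ν.quotient ν).covers ⊆ ν.covers

/-- The locally fine coreflection `λμ`: the smallest locally fine pre-uniformity containing `μ`
(see `isLeast_locallyFineCoreflection`). -/
def locallyFineCoreflection {X : Type u} (μ : PreUniformity X) : PreUniformity X where
  covers := {𝒰 | ⋃₀ 𝒰 = Set.univ ∧
    ∀ ν : PreUniformity X, ν.IsLocallyFine → μ.covers ⊆ ν.covers → 𝒰 ∈ ν.covers}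
  sUnion_eq := fun _ h => h.1
  nonempty := by
    obtain ⟨𝒰, h𝒰⟩ := μ.nonempty
    exact ⟨𝒰, μ.sUnion_eq 𝒰 h𝒰, fun ν _ h => h h𝒰⟩
  of_refines := by
    rintro 𝒰 ⟨hc, h⟩ 𝒱 hr
    refine ⟨Set.eq_univ_of_forall fun x => ?_,
      fun ν hν hμ => ν.of_refines 𝒰 (h ν hν hμ) 𝒱 hr⟩
    obtain ⟨U, hU, hx⟩ := Set.mem_sUnion.1 (hc.symm ▸ Set.mem_univ x)
    obtain ⟨V, hV, hs⟩ := hr U hU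
    exact ⟨V, hV, hs hx⟩
  inter_mem := by
    rintro 𝒰 ⟨hc, h⟩ 𝒱 ⟨hc', h'⟩
    refine ⟨Set.eq_univ_of_forall fun x => ?_,
      fun ν hν hμ => ν.inter_mem 𝒰 (h ν hν hμ) 𝒱 (h' ν hν hμ)⟩
    obtain ⟨U, hU, hx⟩ := Set.mem_sUnion.1 (hc.symm ▸ Set.mem_univ x)
    obtain ⟨V, hV, hx'⟩ := Set.mem_sUnion.1 (hc'.symm ▸ Set.mem_univ x)
    exact ⟨U ∩ V, ⟨U, hU, V, hV, rfl⟩, hx, hx'⟩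

theorem isLeast_locallyFineCoreflection {X : Type u} (μ : PreUniformity X) :
    μ.locallyFineCoreflection.IsLocallyFine ∧
    μ.covers ⊆ μ.locallyFineCoreflection.covers ∧
    ∀ ν : PreUniformity X, ν.IsLocallyFine → μ.covers ⊆ ν.covers →
      μ.locallyFineCoreflection.covers ⊆ ν.covers := by
  refine ⟨fun 𝒲 h𝒲 => ⟨PreUniformity.sUnion_eq _ 𝒲 h𝒲, fun ν hν hμ => ?_⟩,
    fun 𝒰 h𝒰 => ⟨μ.sUnion_eq 𝒰 h𝒰, fun ν _ h => h h𝒰⟩, fun ν hν hμ 𝒰 h𝒰 => h𝒰.2 ν hν hμ⟩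
  obtain ⟨𝒰, h𝒰, 𝒱, h𝒱, hr⟩ := h𝒲
  exact hν ⟨𝒰, h𝒰.2 ν hν hμ, 𝒱, fun U hU => (h𝒱 U hU).2 ν hν hμ, hr⟩

/-- The product pre-uniformity `Πμᵢ` on `Π Xᵢ`, generated by the covers `πᵢ⁻¹[𝒰]`, `𝒰 ∈ μᵢ`: its
covers are those refined by a finite meet `⋀_{i ∈ F} πᵢ⁻¹[𝒰ᵢ]` with `𝒰ᵢ ∈ μᵢ`. -/
def pi {ι : Type u} {X : ι → Type v} (μ : ∀ i, PreUniformity (X i)) :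
    PreUniformity (∀ i, X i) where
  covers := {𝒲 | ∃ (F : Finset ι) (𝒰 : ∀ i, Set (Set (X i))), (∀ i ∈ F, 𝒰 i ∈ (μ i).covers) ∧
    Refines {R | ∃ A : ∀ i, Set (X i), (∀ i ∈ F, A i ∈ 𝒰 i) ∧ R = {x | ∀ i ∈ F, x i ∈ A i}} 𝒲}
  sUnion_eq := by
    rintro 𝒲 ⟨F, 𝒰, h𝒰, hr⟩
    refine Set.eq_univ_of_forall fun x => ?_
    have key : ∀ i, ∃ A : Set (X i), i ∈ F → A ∈ 𝒰 i ∧ x i ∈ A := by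
      intro i
      by_cases hi : i ∈ F
      · obtain ⟨A, hA, hx⟩ :=
          Set.mem_sUnion.1 (((μ i).sUnion_eq _ (h𝒰 i hi)).symm ▸ Set.mem_univ (x i))
        exact ⟨A, fun _ => ⟨hA, hx⟩⟩
      · exact ⟨∅, fun h => absurd h hi⟩
    choose A hA using key
    obtain ⟨W, hW, hs⟩ := hr _ ⟨A, fun i hi => (hA i hi).1, rfl⟩
    exact ⟨W, hW, hs fun i hi => (hA i hi).2⟩
  nonempty := ⟨_, ∅, fun _ => ∅, by simp, fun S hS => ⟨S, hS, subset_rfl⟩⟩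
  of_refines := by
    rintro 𝒲 ⟨F, 𝒰, h𝒰, hr⟩ 𝒲' hr'
    refine ⟨F, 𝒰, h𝒰, fun S hS => ?_⟩
    obtain ⟨W, hW, hs⟩ := hr S hS
    obtain ⟨W', hW', hs'⟩ := hr' W hW
    exact ⟨W', hW', hs.trans hs'⟩
  inter_mem := by
    classical
    rintro 𝒲 ⟨F, 𝒰, h𝒰, hr⟩ 𝒲' ⟨F', 𝒰', h𝒰', hr'⟩
    have key : ∀ i, ∃ 𝒱 : Set (Set (X i)), (i ∈ F ∪ F' → 𝒱 ∈ (μ i).covers) ∧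
        (i ∈ F → Refines 𝒱 (𝒰 i)) ∧ (i ∈ F' → Refines 𝒱 (𝒰' i)) := by
      intro i
      by_cases hi : i ∈ F <;> by_cases hi' : i ∈ F'
      · refine ⟨_, fun _ => (μ i).inter_mem _ (h𝒰 i hi) _ (h𝒰' i hi'), fun _ => ?_, fun _ => ?_⟩
        · rintro _ ⟨U, hU, U', -, rfl⟩
          exact ⟨U, hU, Set.inter_subset_left⟩
        · rintro _ ⟨U, -, U', hU', rfl⟩
          exact ⟨U', hU', Set.inter_subset_right⟩
      · exact ⟨𝒰 i, fun _ => h𝒰 i hi, fun _ S hS => ⟨S, hS, subset_rfl⟩, fun h => absurd h hi'⟩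
      · exact ⟨𝒰' i, fun _ => h𝒰' i hi', fun h => absurd h hi, fun _ S hS => ⟨S, hS, subset_rfl⟩⟩
      · exact ⟨∅, fun h => by simp [hi, hi'] at h, fun h => absurd h hi, fun h => absurd h hi'⟩
    choose 𝒱 h𝒱 h1 h2 using key
    refine ⟨F ∪ F', 𝒱, h𝒱, ?_⟩
    rintro S ⟨A, hA, rfl⟩
    have kB : ∀ i, ∃ B : Set (X i), i ∈ F → B ∈ 𝒰 i ∧ A i ⊆ B := by
      intro i
      by_cases hi : i ∈ F
      · obtain ⟨B, hB⟩ := h1 i hi (A i) (hA i (Finset.mem_union_left _ hi))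
        exact ⟨B, fun _ => hB⟩
      · exact ⟨∅, fun h => absurd h hi⟩
    have kC : ∀ i, ∃ C : Set (X i), i ∈ F' → C ∈ 𝒰' i ∧ A i ⊆ C := by
      intro i
      by_cases hi : i ∈ F'
      · obtain ⟨C, hC⟩ := h2 i hi (A i) (hA i (Finset.mem_union_right _ hi))
        exact ⟨C, fun _ => hC⟩
      · exact ⟨∅, fun h => absurd h hi⟩
    choose B hB using kB
    choose C hC using kC
    obtain ⟨W, hW, hs⟩ := hr _ ⟨B, fun i hi => (hB i hi).1, rfl⟩
    obtain ⟨W', hW', hs'⟩ := hr' _ ⟨C, fun i hi => (hC i hi).1, rfl⟩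
    refine ⟨W ∩ W', ⟨W, hW, W', hW', rfl⟩, fun x hx => ⟨hs fun i hi => ?_, hs' fun i hi => ?_⟩⟩
    · exact (hB i hi).2 (hx i (Finset.mem_union_left _ hi))
    · exact (hC i hi).2 (hx i (Finset.mem_union_right _ hi))

/-- A pre-uniformity on a topological space is supercomplete if it contains every open cover. -/
def IsSupercomplete {X : Type u} [TopologicalSpace X] (μ : PreUniformity X) : Prop :=
  ∀ 𝒢 : Set (Set X), (∀ G ∈ 𝒢, IsOpen G) → ⋃₀ 𝒢 = Set.univ → 𝒢 ∈ μ.covers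

end PreUniformity

/-- A left-open partition of a space: a partition with a well-ordering of its members such that
the union of the members up to and including any given one is open. -/
structure LeftOpenPartition (X : Type u) [TopologicalSpace X] where
  parts : Set (Set X)
  isPartition : Setoid.IsPartition parts
  /-- The strict order of the members. -/
  lt : parts → parts → Prop
  isWellOrder : IsWellOrder parts lt
  isOpen_iUnion : ∀ P : parts, IsOpen {x : X | ∃ Q : parts, (lt Q P ∨ Q = P) ∧ x ∈ (Q : Set X)}

/-- A sequence of left-open partitions is complete if each partition refines the preceding one,
with compatible orders, and every (proper) filter that contains a member of each partition has a
cluster point. -/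
structure IsCompleteSequence {X : Type u} [TopologicalSpace X]
    (𝔓 : ℕ → LeftOpenPartition X) : Prop where
  refines : ∀ n, Refines (𝔓 (n + 1)).parts (𝔓 n).parts
  order_compatible : ∀ n, ∀ P P' : (𝔓 n).parts, ∀ Q Q' : (𝔓 (n + 1)).parts,
    (Q : Set X) ⊆ P → (Q' : Set X) ⊆ P' → (𝔓 n).lt P P' → (𝔓 (n + 1)).lt Q Q'
  exists_clusterPt : ∀ ℱ : Filter X, ℱ.NeBot → (∀ n, ∃ P ∈ (𝔓 n).parts, P ∈ ℱ) →
    ∃ x, ClusterPt x ℱ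

/-- A space is partition-complete if it has a complete sequence of left-open partitions. -/
def PartitionComplete (X : Type u) [TopologicalSpace X] : Prop :=
  ∃ 𝔓 : ℕ → LeftOpenPartition X, IsCompleteSequence 𝔓

/-! Fix an open cover `𝒢` and call a set bad if no cover in `λΠμᵢ` has traces on it that refine `𝒢`.
Supercompleteness of `μᵢ` and local fineness make badness localize along every projection
(`IsLocallyFine.isSmall_of_forall`). If the whole product were bad, it would be bad near some point
`x` (`exists_forall_mem_nhds_bad`), yet a member of `𝒢` around `x` is not bad.

The point comes from a minimal filter `H` of bad sets. Countability lets one decreasing sequence of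
bad sets settle a first member for every partition of every factor; `H` is taken below that
sequence. In each factor the first members decrease, and their traces on closures of images of sets
in `H` behave like a compact set: completeness gives a point near which `H` stays bad
(`exists_forall_mem_inf_comap_nhds_bad`). By minimality `H` converges to that point in each
coordinate, hence in the product. -/

open Set Filter Topology

namespace LeftOpenPartition

variable {Y : Type*} [TopologicalSpace Y] (𝔓 : LeftOpenPartition Y)

/-- The union of the members of a left-open partition up to and including a given one. -/
def initial (P : 𝔓.parts) : Set Y :=
  {x | ∃ Q : 𝔓.parts, (𝔓.lt Q P ∨ Q = P) ∧ x ∈ (Q : Set Y)}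

theorem isOpen_initial (P : 𝔓.parts) : IsOpen (𝔓.initial P) := 𝔓.isOpen_iUnion P

theorem exists_mem (y : Y) : ∃ P : 𝔓.parts, y ∈ (P : Set Y) := by
  obtain ⟨P, ⟨hP, hy⟩, -⟩ := 𝔓.isPartition.2 y
  exact ⟨⟨P, hP⟩, hy⟩

theorem eq_of_mem {y : Y} {P Q : 𝔓.parts} (hP : y ∈ (P : Set Y)) (hQ : y ∈ (Q : Set Y)) :
    P = Q :=
  Subtype.ext ((𝔓.isPartition.2 y).unique ⟨P.2, hP⟩ ⟨Q.2, hQ⟩)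

theorem lt_trichotomy (P Q : 𝔓.parts) : 𝔓.lt P Q ∨ P = Q ∨ 𝔓.lt Q P := by
  have := 𝔓.isWellOrder
  exact trichotomous_of 𝔓.lt P Q

theorem not_lt_of_le {P Q : 𝔓.parts} (h : 𝔓.lt P Q ∨ P = Q) : ¬ 𝔓.lt Q P := by
  have := 𝔓.isWellOrder
  rintro h'
  rcases h with h | rfl
  · exact asymm_of 𝔓.lt h h'
  · exact irrefl_of 𝔓.lt P h'

end LeftOpenPartition

/-! ### Localizing bad sets in a single factor -/

section Localization

variable {Z Y : Type*} [TopologicalSpace Y]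

/-- `Bad` localizes along `f : Z → Y` if for every open cover of `Y`, every bad set meets the
preimage of some member of the cover in a bad set. -/
def LocalizesAlong (Bad : Set Z → Prop) (f : Z → Y) : Prop :=
  ∀ A, Bad A → ∀ 𝒪 : Set (Set Y), (∀ O ∈ 𝒪, IsOpen O) → ⋃₀ 𝒪 = univ →
    ∃ O ∈ 𝒪, Bad (A ∩ f ⁻¹' O)

theorem closure_image_inter_preimage_subset (f : Z → Y) (A : Set Z) (U : Set Y) :
    closure (f '' (A ∩ f ⁻¹' U)) ⊆ closure U :=
  closure_mono (by rintro _ ⟨z, hz, rfl⟩; exact hz.2)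

/-- `P` is the first member of the left-open partition `𝔓` such that the image of some bad subset
of `A` has closure inside the initial segment of `P`, and the image of `A` itself is such. -/
structure IsFirstFor (Bad : Set Z → Prop) (f : Z → Y) (𝔓 : LeftOpenPartition Y) (A : Set Z)
    (P : 𝔓.parts) : Prop where
  closure_subset : closure (f '' A) ⊆ 𝔓.initial P
  not_closure_subset : ∀ B ⊆ A, Bad B → ∀ Q, 𝔓.lt Q P → ¬ closure (f '' B) ⊆ 𝔓.initial Q

theorem IsFirstFor.mono {Bad : Set Z → Prop} {f : Z → Y} {𝔓 : LeftOpenPartition Y} {A B : Set Z}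
    {P : 𝔓.parts} (h : IsFirstFor Bad f 𝔓 A P) (hBA : B ⊆ A) : IsFirstFor Bad f 𝔓 B P :=
  ⟨(closure_mono (image_mono hBA)).trans h.closure_subset,
    fun C hC => h.not_closure_subset C (hC.trans hBA)⟩

variable [RegularSpace Y] {Bad : Set Z → Prop} {f : Z → Y}

theorem exists_isOpen_closure_subset {y : Y} {O : Set Y} (hO : IsOpen O) (hy : y ∈ O) :
    ∃ U, IsOpen U ∧ y ∈ U ∧ closure U ⊆ O := by
  obtain ⟨C, ⟨hC, hCc⟩, hCO⟩ := (closed_nhds_basis y).mem_iff.1 (hO.mem_nhds hy)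
  exact ⟨interior C, isOpen_interior, mem_interior_iff_mem_nhds.2 hC,
    (closure_minimal interior_subset hCc).trans hCO⟩

/-- By regularity, the open sets with closure inside some initial segment cover `Y`, so some bad
subset of `A` has its image closure in one. The well-order then yields the least segment attained by
bad subsets of `A`. -/
theorem LocalizesAlong.exists_isFirstFor (hf : LocalizesAlong Bad f) (𝔓 : LeftOpenPartition Y)
    {A : Set Z} (hA : Bad A) : ∃ B ⊆ A, Bad B ∧ ∃ P, IsFirstFor Bad f 𝔓 B P := by
  obtain ⟨U, ⟨-, P, hP⟩, hU⟩ := hf A hA {U | IsOpen U ∧ ∃ P, closure U ⊆ 𝔓.initial P}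
    (fun U hU => hU.1) (by
      refine eq_univ_of_forall fun y => ?_
      obtain ⟨P, hP⟩ := 𝔓.exists_mem y
      obtain ⟨U, hU, hyU, hUP⟩ :=
        exists_isOpen_closure_subset (𝔓.isOpen_initial P) ⟨P, Or.inr rfl, hP⟩
      exact ⟨U, ⟨hU, P, hUP⟩, hyU⟩)
  let S : Set 𝔓.parts := {P | ∃ B ⊆ A, Bad B ∧ closure (f '' B) ⊆ 𝔓.initial P}
  have hS : S.Nonempty :=
    ⟨P, _, inter_subset_left, hU, (closure_image_inter_preimage_subset f A U).trans hP⟩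
  have hwf : WellFounded 𝔓.lt := 𝔓.isWellOrder.wf
  obtain ⟨B, hBA, hB, hBP⟩ := hwf.min_mem S hS
  exact ⟨B, hBA, hB, hwf.min S hS, hBP, fun C hC hbad Q hQ hCQ =>
    hwf.not_lt_min S ⟨C, hC.trans hBA, hbad, hCQ⟩ hQ⟩

/-- A bad set can be localized to any open family covering the trace of its first member. -/
theorem IsFirstFor.exists_bad_inter_preimage (hmono : ∀ A B, A ⊆ B → Bad A → Bad B)
    (hempty : ¬ Bad ∅) (hf : LocalizesAlong Bad f) {𝔓 : LeftOpenPartition Y} {A : Set Z}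
    {P : 𝔓.parts} (h : IsFirstFor Bad f 𝔓 A P) (hA : Bad A) {𝒱 : Set (Set Y)}
    (h𝒱 : ∀ V ∈ 𝒱, IsOpen V) (hcov : (P : Set Y) ∩ closure (f '' A) ⊆ ⋃₀ 𝒱) :
    ∃ V ∈ 𝒱, Bad (A ∩ f ⁻¹' V) := by
  -- Besides `𝒱`, the cover uses sets that no bad piece can lie over: those with closure in an
  -- earlier segment, by minimality of `P`, and the complement of the image closure, by `hempty`.
  obtain ⟨U, ⟨-, hU⟩, hbad⟩ := hf A hA
    {U | IsOpen U ∧ (U ∈ 𝒱 ∨ (∃ Q, 𝔓.lt Q P ∧ closure U ⊆ 𝔓.initial Q) ∨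
      U = (closure (f '' A))ᶜ)} (fun U hU => hU.1) (by
      refine eq_univ_of_forall fun y => ?_
      by_cases hy : y ∈ closure (f '' A)
      · obtain ⟨Q, hQ, hyQ⟩ := h.closure_subset hy
        rcases hQ with hQ | rfl
        · obtain ⟨U, hU, hyU, hUQ⟩ :=
            exists_isOpen_closure_subset (𝔓.isOpen_initial Q) ⟨Q, Or.inr rfl, hyQ⟩
          exact ⟨U, ⟨hU, Or.inr (Or.inl ⟨Q, hQ, hUQ⟩)⟩, hyU⟩
        · obtain ⟨V, hV, hyV⟩ := hcov ⟨hyQ, hy⟩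
          exact ⟨V, ⟨h𝒱 V hV, Or.inl hV⟩, hyV⟩
      · exact ⟨_, ⟨isClosed_closure.isOpen_compl, Or.inr (Or.inr rfl)⟩, hy⟩)
  rcases hU with hU | ⟨Q, hQ, hUQ⟩ | rfl
  · exact ⟨U, hU, hbad⟩
  · exact absurd ((closure_image_inter_preimage_subset f A U).trans hUQ)
      (h.not_closure_subset _ inter_subset_left hbad Q hQ)
  · refine absurd (hmono _ _ ?_ hbad) hempty
    rintro z ⟨hz, hz'⟩
    exact hz' (subset_closure (mem_image_of_mem f hz))

/-- Let `Q ⊆ P'`. If `P' < P`, compatibility of the orders puts the segment of `Q` inside that of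
`P'`, against minimality of `P`. If `P < P'`, then `Q` misses the image closure. -/
theorem IsFirstFor.subset_of_isCompleteSequence (hmono : ∀ A B, A ⊆ B → Bad A → Bad B)
    (hempty : ¬ Bad ∅) (hf : LocalizesAlong Bad f) {𝔓 : ℕ → LeftOpenPartition Y}
    (h𝔓 : IsCompleteSequence 𝔓) {A : Set Z} (hA : Bad A) {k : ℕ} {P : (𝔓 k).parts}
    {Q : (𝔓 (k + 1)).parts} (hP : IsFirstFor Bad f (𝔓 k) A P)
    (hQ : IsFirstFor Bad f (𝔓 (k + 1)) A Q) : (Q : Set Y) ⊆ P := by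
  obtain ⟨P', hP', hQP'⟩ := h𝔓.refines k Q Q.2
  lift P' to (𝔓 k).parts using hP'
  rcases (𝔓 k).lt_trichotomy P' P with hlt | rfl | hlt
  · refine absurd (hQ.closure_subset.trans ?_) (hP.not_closure_subset A subset_rfl hA P' hlt)
    rintro y ⟨Q', hQ', hy⟩
    obtain ⟨P'', hP'', hQP''⟩ := h𝔓.refines k Q' Q'.2
    lift P'' to (𝔓 k).parts using hP''
    refine ⟨P'', ?_, hQP'' hy⟩
    rcases (𝔓 k).lt_trichotomy P'' P' with h | h | h
    · exact Or.inl h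
    · exact Or.inr h
    · exact absurd (h𝔓.order_compatible k P' P'' Q Q' hQP' hQP'' h)
        ((𝔓 (k + 1)).not_lt_of_le hQ')
  · exact hQP'
  -- The trace of `Q` is empty, so even the empty family covers it.
  · obtain ⟨V, hV, -⟩ := hQ.exists_bad_inter_preimage hmono hempty hf hA (𝒱 := ∅) (by simp) (by
      rintro y ⟨hyQ, hy⟩
      obtain ⟨P'', hP'', hyP''⟩ := hP.closure_subset hy
      obtain rfl := (𝔓 k).eq_of_mem (hQP' hyQ) hyP''
      exact absurd hlt ((𝔓 k).not_lt_of_le hP''))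
    exact absurd hV (notMem_empty V)

/-- A filter of bad sets that, for each partition of a complete sequence, contains a set having a
first member, can be localized at a point. -/
theorem exists_forall_mem_inf_comap_nhds_bad (hmono : ∀ A B, A ⊆ B → Bad A → Bad B)
    (hempty : ¬ Bad ∅) (hf : LocalizesAlong Bad f) {𝔓 : ℕ → LeftOpenPartition Y}
    (h𝔓 : IsCompleteSequence 𝔓) {H : Filter Z} (hH : ∀ A ∈ H, Bad A)
    (hfirst : ∀ k, ∃ A ∈ H, ∃ P, IsFirstFor Bad f (𝔓 k) A P) :
    ∃ y, ∀ A ∈ H ⊓ comap f (𝓝 y), Bad A := by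
  classical
  choose A hAH P hP using hfirst
  have hanti : Antitone fun k => (P k : Set Y) := antitone_nat_of_succ_le fun k =>
    ((hP k).mono inter_subset_left).subset_of_isCompleteSequence hmono hempty hf h𝔓
      (hH _ (inter_mem (hAH k) (hAH (k + 1)))) ((hP (k + 1)).mono inter_subset_right)
  by_contra! hcon
  have hex : ∀ y, ∃ B ∈ H, ∃ V, IsOpen V ∧ y ∈ V ∧ ¬ Bad (B ∩ f ⁻¹' V) := by
    intro y
    obtain ⟨C, hC, hCbad⟩ := hcon y
    obtain ⟨B, hB, W, hW, rfl⟩ := mem_inf_iff.1 hC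
    obtain ⟨N, hN, hNW⟩ := mem_comap.1 hW
    obtain ⟨V, hVN, hV, hyV⟩ := mem_nhds_iff.1 hN
    exact ⟨B, hB, V, hV, hyV, fun h =>
      hCbad (hmono _ _ (inter_subset_inter_right B ((preimage_mono hVN).trans hNW)) h)⟩
  choose B hBH V hV hyV hBV using hex
  -- `L` is generated by the traces of the `P k` and the complements of the `V y`. A cluster point
  -- `y` of `L` would contradict `(V y)ᶜ ∈ L`.
  let L : Filter Y :=
    { sets := {S | ∃ k, ∃ C ∈ H, ∃ t : Finset Y,
        (P k : Set Y) ∩ closure (f '' C) ⊆ S ∪ ⋃ y ∈ t, V y}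
      univ_sets := ⟨0, univ, univ_mem, ∅, by simp⟩
      sets_of_superset := by
        rintro S T ⟨k, C, hC, t, h⟩ hST
        exact ⟨k, C, hC, t, h.trans (union_subset_union_left _ hST)⟩
      inter_sets := by
        rintro S T ⟨k, C, hC, t, h⟩ ⟨k', C', hC', t', h'⟩
        refine ⟨max k k', C ∩ C', inter_mem hC hC', t ∪ t', ?_⟩
        rintro y ⟨hyP, hyC⟩
        have h1 := h ⟨hanti (le_max_left k k') hyP,
          closure_mono (image_mono inter_subset_left) hyC⟩
        have h2 := h' ⟨hanti (le_max_right k k') hyP,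
          closure_mono (image_mono inter_subset_right) hyC⟩
        rw [Finset.set_biUnion_union]
        rcases h1 with h1 | h1
        · rcases h2 with h2 | h2
          · exact Or.inl ⟨h1, h2⟩
          · exact Or.inr (Or.inr h2)
        · exact Or.inr (Or.inl h1) }
  have hL : ∀ S, S ∈ L ↔ ∃ k, ∃ C ∈ H, ∃ t : Finset Y,
      (P k : Set Y) ∩ closure (f '' C) ⊆ S ∪ ⋃ y ∈ t, V y := fun S => Iff.rfl
  have hLne : L.NeBot := by
    refine neBot_iff.2 fun hbot => ?_
    obtain ⟨k, C, hC, t, h⟩ := (hL ∅).1 (hbot ▸ mem_bot)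
    rw [empty_union] at h
    -- Intersecting with the finitely many `B y` ensures that the bad piece over any `V y` lies in
    -- the corresponding `B y`.
    have hmem : C ∩ A k ∩ ⋂ y ∈ t, B y ∈ H :=
      inter_mem (inter_mem hC (hAH k)) ((biInter_finset_mem t).2 fun y _ => hBH y)
    obtain ⟨W, ⟨y, hy, rfl⟩, hbad⟩ := ((hP k).mono (B := C ∩ A k ∩ ⋂ y ∈ t, B y)
      (fun z hz => hz.1.2)).exists_bad_inter_preimage hmono hempty hf (hH _ hmem)
      (𝒱 := V '' t) (by rintro _ ⟨y, -, rfl⟩; exact hV y) (by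
        rw [sUnion_image]
        exact (inter_subset_inter_right _
          (closure_mono (image_mono fun z hz => hz.1.1))).trans h)
    refine hBV y (hmono _ _ ?_ hbad)
    rintro z ⟨⟨-, hz⟩, hz'⟩
    exact ⟨mem_iInter₂.1 hz y hy, hz'⟩
  obtain ⟨y, hy⟩ := h𝔓.exists_clusterPt L hLne fun k =>
    ⟨P k, (P k).2, (hL _).2 ⟨k, univ, univ_mem, ∅, inter_subset_left.trans subset_union_left⟩⟩
  have hVL : (V y)ᶜ ∈ L := (hL _).2 ⟨0, univ, univ_mem, {y}, by simp⟩
  obtain ⟨z, hz, hz'⟩ := clusterPt_iff_nonempty.1 hy ((hV y).mem_nhds (hyV y)) hVL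
  exact hz' hz

end Localization

/-! ### Convergence in the countable product -/

/-- A filter of bad sets contains a minimal one. -/
theorem Filter.exists_le_minimal_forall_mem {Z : Type*} {Bad : Set Z → Prop} {F : Filter Z}
    (hF : ∀ A ∈ F, Bad A) : ∃ H ≤ F, Minimal (fun H : Filter Z => ∀ A ∈ H, Bad A) H := by
  refine @zorn_le_nonempty₀ (Filter Z)ᵒᵈ _ {H | ∀ A ∈ OrderDual.ofDual H, Bad A} ?_
    (OrderDual.toDual F) hF
  intro c hc hchain y hy
  refine ⟨OrderDual.toDual (⨅ G ∈ c, OrderDual.ofDual G), ?_, fun G hG => OrderDual.le_toDual.2 (iInf₂_le G hG)⟩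
  intro A hA
  rw [OrderDual.ofDual_toDual, mem_biInf_of_directed _ ⟨y, hy⟩] at hA
  · obtain ⟨G, hG, hAG⟩ := hA
    exact hc hG A hAG
  · exact hchain.directedOn

/-- In a countable product of partition-complete regular spaces, a monotone notion of badness that
localizes along every projection localizes at a point. -/
theorem exists_forall_mem_nhds_bad {ι : Type*} [Countable ι] {X : ι → Type*}
    [∀ i, TopologicalSpace (X i)] [∀ i, RegularSpace (X i)] (hX : ∀ i, PartitionComplete (X i))
    {Bad : Set (∀ i, X i) → Prop} (hmono : ∀ A B, A ⊆ B → Bad A → Bad B) (hempty : ¬ Bad ∅)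
    (hloc : ∀ i, LocalizesAlong Bad fun x : ∀ i, X i => x i) (huniv : Bad univ) :
    ∃ x, ∀ A ∈ 𝓝 x, Bad A := by
  choose 𝔓 h𝔓 using hX
  have : Encodable ι := Encodable.ofCountable ι
  -- In the dual order, shrinking a bad set moves up, and `exists_isFirstFor` is exactly cofinality.
  let 𝒟 : ι × ℕ → Order.Cofinal {A : Set (∀ i, X i) // Bad A}ᵒᵈ := fun p =>
    { carrier := {A | ∃ P, IsFirstFor Bad (fun x : ∀ i, X i => x p.1) (𝔓 p.1 p.2)
        (OrderDual.ofDual A).1 P}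
      isCofinal := fun A => by
        obtain ⟨B, hBA, hB, P, hP⟩ := (hloc p.1).exists_isFirstFor (𝔓 p.1 p.2)
          (OrderDual.ofDual A).2
        exact ⟨OrderDual.toDual ⟨B, hB⟩, ⟨P, hP⟩, hBA⟩ }
  let s := Order.sequenceOfCofinals (OrderDual.toDual ⟨univ, huniv⟩) 𝒟
  let A : ℕ → Set (∀ i, X i) := fun n => (OrderDual.ofDual (s n)).1
  have hAanti : Antitone A := fun m n hmn => Order.sequenceOfCofinals.monotone _ 𝒟 hmn
  have hmem : ∀ S, S ∈ ⨅ n, 𝓟 (A n) ↔ ∃ n, A n ⊆ S := fun S => by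
    rw [mem_iInf_of_directed (directed_of_isDirected_le fun m n hmn =>
      principal_mono.2 (hAanti hmn))]
    simp only [mem_principal]
  obtain ⟨H, hHA, hH⟩ := exists_le_minimal_forall_mem (F := ⨅ n, 𝓟 (A n)) (Bad := Bad)
    fun S hS => by
      obtain ⟨n, hn⟩ := (hmem S).1 hS
      exact hmono _ _ hn (OrderDual.ofDual (s n)).2
  have hpt : ∀ i, ∃ y, H ≤ comap (fun x : ∀ i, X i => x i) (𝓝 y) := fun i => by
    obtain ⟨y, hy⟩ := exists_forall_mem_inf_comap_nhds_bad hmono hempty (hloc i) (h𝔓 i) hH.prop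
      -- The condition with code `n` is met at stage `n + 1`.
      fun k => ⟨A (Encodable.encode (i, k) + 1), hHA ((hmem _).2 ⟨_, subset_rfl⟩),
        Order.sequenceOfCofinals.encode_mem _ 𝒟 (i, k)⟩
    exact ⟨y, (hH.le_of_le hy inf_le_left).trans inf_le_right⟩
  choose x hx using hpt
  refine ⟨x, fun S hS => hH.prop S ?_⟩
  have : H ≤ 𝓝 x := by
    rw [nhds_pi]
    exact le_iInf hx
  exact this hS

/-! ### Uniform smallness and local fineness -/

namespace PreUniformity

/-- The inverse image of a uniform cover under a projection is uniform for the product. -/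
theorem preimage_mem_pi {ι : Type*} {X : ι → Type*} (μ : ∀ i, PreUniformity (X i)) (i : ι)
    {𝒰 : Set (Set (X i))} (h𝒰 : 𝒰 ∈ (μ i).covers) :
    (fun U => (fun x : ∀ i, X i => x i) ⁻¹' U) '' 𝒰 ∈ (pi μ).covers := by
  classical
  refine ⟨{i}, Function.update (fun _ => ∅) i 𝒰, ?_, ?_⟩
  · intro j hj
    obtain rfl := Finset.mem_singleton.1 hj
    simpa using h𝒰
  · rintro _ ⟨A, hA, rfl⟩
    have hAi := hA i (Finset.mem_singleton_self i)
    rw [Function.update_self] at hAi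
    exact ⟨_, ⟨A i, hAi, rfl⟩, fun x hx => hx i (Finset.mem_singleton_self i)⟩

/-- `A` is uniformly small for `𝒢` if the members of some uniform cover meet `A` in sets contained
in members of `𝒢`. -/
def IsSmall {Z : Type*} (ν : PreUniformity Z) (𝒢 : Set (Set Z)) (A : Set Z) : Prop :=
  ∃ 𝒱 ∈ ν.covers, ∀ V ∈ 𝒱, ∃ G ∈ 𝒢, A ∩ V ⊆ G

theorem IsSmall.mono {Z : Type*} {ν : PreUniformity Z} {𝒢 : Set (Set Z)} {A B : Set Z}
    (hB : ν.IsSmall 𝒢 B) (hAB : A ⊆ B) : ν.IsSmall 𝒢 A := by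
  obtain ⟨𝒱, h𝒱, h⟩ := hB
  refine ⟨𝒱, h𝒱, fun V hV => ?_⟩
  obtain ⟨G, hG, hs⟩ := h V hV
  exact ⟨G, hG, (inter_subset_inter_left V hAB).trans hs⟩

theorem isSmall_of_subset {Z : Type*} (ν : PreUniformity Z) {𝒢 : Set (Set Z)} {A G : Set Z}
    (hG : G ∈ 𝒢) (hAG : A ⊆ G) : ν.IsSmall 𝒢 A := by
  obtain ⟨𝒱, h𝒱⟩ := ν.nonempty
  exact ⟨𝒱, h𝒱, fun V _ => ⟨G, hG, inter_subset_left.trans hAG⟩⟩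

theorem IsSmall.mem_covers {Z : Type*} {ν : PreUniformity Z} {𝒢 : Set (Set Z)}
    (h : ν.IsSmall 𝒢 univ) : 𝒢 ∈ ν.covers := by
  obtain ⟨𝒱, h𝒱, h⟩ := h
  exact ν.of_refines 𝒱 h𝒱 𝒢 fun V hV => by simpa using h V hV

/-- The covers witnessing smallness of the pieces `A ∩ U`, each cut down to its `U`, assemble into a
cover in `ν/ν`. -/
theorem IsLocallyFine.isSmall_of_forall {Z : Type*} {ν : PreUniformity Z} (hν : ν.IsLocallyFine)
    {𝒢 𝒰 : Set (Set Z)} {A : Set Z} (h𝒰 : 𝒰 ∈ ν.covers)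
    (h : ∀ U ∈ 𝒰, ν.IsSmall 𝒢 (A ∩ U)) : ν.IsSmall 𝒢 A := by
  choose! 𝒱 h𝒱 hs using h
  refine ⟨_, hν ⟨𝒰, h𝒰, 𝒱, h𝒱, fun S hS => ⟨S, hS, subset_rfl⟩⟩, ?_⟩
  rintro _ ⟨U, hU, V, hV, rfl⟩
  obtain ⟨G, hG, hsub⟩ := hs U hU V hV
  exact ⟨G, hG, by rwa [← inter_assoc]⟩

end PreUniformity

theorem theorem6p1 {ι : Type u} [Countable ι] (X : ι → Type v)
    [∀ i, TopologicalSpace (X i)] [∀ i, RegularSpace (X i)]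
    (hX : ∀ i, PartitionComplete (X i))
    (μ : ∀ i, PreUniformity (X i)) (hμ : ∀ i, (μ i).IsSupercomplete) :
    (PreUniformity.pi μ).locallyFineCoreflection.IsSupercomplete := by
  intro 𝒢 h𝒢 hcov
  obtain ⟨hfine, hle, -⟩ := (PreUniformity.pi μ).isLeast_locallyFineCoreflection
  set ν := (PreUniformity.pi μ).locallyFineCoreflection
  have hloc : ∀ i, LocalizesAlong (fun A => ¬ ν.IsSmall 𝒢 A) fun x : ∀ i, X i => x i := by
    intro i A hA 𝒪 h𝒪 h𝒪cov
    by_contra! hcon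
    refine hA (hfine.isSmall_of_forall
      (hle (PreUniformity.preimage_mem_pi μ i (hμ i 𝒪 h𝒪 h𝒪cov))) ?_)
    rintro _ ⟨O, hO, rfl⟩
    exact hcon O hO
  refine PreUniformity.IsSmall.mem_covers (by_contra fun huniv => ?_)
  -- That `∅` is not bad is derived from a member of `𝒢`, which an empty product need not supply.
  -- There some factor is empty, and localizing to its empty cover is absurd.
  rcases isEmpty_or_nonempty (∀ i, X i) with he | ⟨⟨x⟩⟩
  · obtain ⟨i, hi⟩ := isEmpty_pi.1 he
    obtain ⟨O, hO, -⟩ := hloc i univ huniv ∅ (by simp) (Subsingleton.elim _ _)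
    exact notMem_empty O hO
  · obtain ⟨G, hG, -⟩ := mem_sUnion.1 (hcov.symm ▸ mem_univ x)
    obtain ⟨x, hx⟩ := exists_forall_mem_nhds_bad hX
      (fun A B hAB hA hB => hA (hB.mono hAB))
      (fun h => h (ν.isSmall_of_subset hG (empty_subset G))) hloc huniv
    obtain ⟨G, hG, hxG⟩ := mem_sUnion.1 (hcov.symm ▸ mem_univ x)
    exact hx G ((h𝒢 G hG).mem_nhds hxG) (ν.isSmall_of_subset hG subset_rfl)
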